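/- Let $\mathbb{K}$ be an arbitrary field, let $n$ be a non-negative integer, and let $\mathrm{S}_n(\mathbb{K})$ be the space of all symmetric $n\times n$ matrices over $\mathbb{K}$. For a linear subspace $\mathcal{T}$ of $\mathrm{S}_n(\mathbb{K})$, a group homomorphism $F:\mathcal{T}\to\mathbb{K}^n$ is called range-compatible if $F(M)$ belongs to the column space of $M$ for every $M\in\mathcal{T}$; it is called local if there is a vector $x\in\mathbb{K}^n$ such that $F(M)=Mx$ for all $M\in\mathcal{T}$. A range-compatible homomorphism on $\mathcal{T}$ is called standard if it extends to a range-compatible homomorphism on $\mathrm{S}_n(\mathbb{K})$. If $\mathbb{K}$ has characteristic $2$, a root-linear map $\alpha:\mathbb{K}\to\mathbb{K}$ is a homomorphism of additive groups such that $\alpha(\lambda^2x)=\lambda\,\alpha(x)$ for all $\lambda,x\in\mathbb{K}$. For $M=(m_{i,j})\in \mathrm{S}_n(\mathbb{K})$ and $\alpha:\mathbb{K}\to\mathbb{K}$, write $\Delta(M)^\alpha:=(\alpha(m_{1,1}),\dots,\alpha(m_{n,n}))^T\in\mathbb{K}^n$. **Theorem.** Let $\mathcal{S}$ be a linear subspace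 of $\mathrm{S}_n(\mathbb{K})$ whose codimension in $\mathrm{S}_n(\mathbb{K})$ is at most $n-2$ (so that $n\ge 2$). Then: 1. Every range-compatible group homomorphism on $\mathcal{S}$ is standard. 2. If $\mathbb{K}$ does not have characteristic $2$, a group homomorphism $F:\mathcal{S}\to\mathbb{K}^n$ is range-compatible if and only if it is local. 3. If $\mathbb{K}$ has characteristic $2$, a group homomorphism $F:\mathcal{S}\to\mathbb{K}^n$ is range-compatible if and only if it is the sum of a local map and of a map $M\mapsto\Delta(M)^\alpha$ for some root-linear map $\alpha:\mathbb{K}\to\mathbb{K}$. -/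

import Mathlib

/-- The space of symmetric `n × n` matrices over `K`. -/
def symMatrices (K : Type*) [Field K] (n : ℕ) : Submodule K (Matrix (Fin n) (Fin n) K) where
  carrier := {M | M.IsSymm}
  add_mem' := fun hA hB => Matrix.IsSymm.add hA hB
  zero_mem' := Matrix.isSymm_zero
  smul_mem' := fun c _ hA => Matrix.IsSymm.smul hA c

/-- The codimension of `S` in the space of symmetric matrices
(the dimension of the quotient; meant for `S` contained in that space). -/
noncomputable def symCodim {K : Type*} [Field K] {n : ℕ}
    (S : Submodule K (Matrix (Fin n) (Fin n) K)) : ℕ :=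
  Module.finrank K (symMatrices K n ⧸ S.submoduleOf (symMatrices K n))

/-- `F` is range-compatible: `F M` lies in the range (column space) of `M`, for all `M` in `S`. -/
def IsRangeCompatible {K : Type*} [Field K] {n : ℕ}
    {S : Submodule K (Matrix (Fin n) (Fin n) K)} (F : S → (Fin n → K)) : Prop :=
  ∀ M : S, F M ∈ LinearMap.range (M : Matrix (Fin n) (Fin n) K).mulVecLin

/-- `F` is local: it is the evaluation `M ↦ M x` at some fixed vector `x`. -/
def IsLocalMap {K : Type*} [Field K] {n : ℕ}
    {S : Submodule K (Matrix (Fin n) (Fin n) K)} (F : S → (Fin n → K)) : Prop :=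
  ∃ x : Fin n → K, ∀ M : S, F M = (M : Matrix (Fin n) (Fin n) K).mulVec x

/-- A range-compatible homomorphism `F` on a space `S` of symmetric matrices is standard when it
extends to a range-compatible homomorphism on the space of all symmetric matrices. -/
def IsStandard {K : Type*} [Field K] {n : ℕ}
    {S : Submodule K (Matrix (Fin n) (Fin n) K)} (hS : S ≤ symMatrices K n)
    (F : S →+ (Fin n → K)) : Prop :=
  IsRangeCompatible (F : S → (Fin n → K)) ∧
    ∃ G : symMatrices K n →+ (Fin n → K),
      IsRangeCompatible (G : symMatrices K n → (Fin n → K)) ∧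
        ∀ M : S, G (Submodule.inclusion hS M) = F M

/-- Root-linear maps (used over fields of characteristic 2): additive maps `α` such that
`α (c ^ 2 • x) = c • α x`. -/
def IsRootLinear (K : Type*) [Field K] {V W : Type*} [AddCommGroup V] [Module K V]
    [AddCommGroup W] [Module K W] (α : V →+ W) : Prop :=
  ∀ (c : K) (x : V), α (c ^ 2 • x) = c • α x

open Matrix

/-! For symmetric `M` the range is the orthogonal of the kernel, so range-compatibility says that `F
M ⬝ᵥ x = 0` whenever `M x = 0`. This can be tested on any subspace `X`. The goal becomes `F M ⬝ᵥ x =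
M x ⬝ᵥ v + α (M x ⬝ᵥ x)` for `x ∈ X`, and `X = ⊤` gives all three claims, since a root-linear `α`
satisfies `2α = 0`.

The proof (`exists_standard_on`) is by induction on `dim X`, assuming that `T = S + {matrices
vanishing on X}` has codimension at most `dim X - 2`. If `dim X = 2`, then `T` is the full space and
a functional equation in one variable settles the matter. Otherwise there are forms `f₁`, `f₂`,
independent on `X`, such that cutting `X` by either one keeps the codimension bound: `f fᵀ` vanishes
on `X ∩ ker f`, so it enlarges `T` if it is not already there. Induction gives a pair `(v, α)` on
each of the two hyperplanes of `X`.

On the intersection `Y` the two formulas agree for all matrices in `T`. A dimension count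
(`standard_eq_zero_or`) then forces the pairs to coincide, and the formula extends to `X` because
its solution set in `x` is a subspace. The count fails only over the field with two elements, in a
configuration refuted by `false_of_exceptional`. -/

/-- The symmetric matrices whose kernel contains `X`. -/
def symVanishingOn {K : Type*} [Field K] {n : ℕ} (X : Submodule K (Fin n → K)) :
    Submodule K (Matrix (Fin n) (Fin n) K) where
  carrier := {M | M.IsSymm ∧ ∀ x ∈ X, M *ᵥ x = 0}
  add_mem' := fun hA hB => ⟨hA.1.add hB.1, fun x hx => by
    rw [add_mulVec, hA.2 x hx, hB.2 x hx, add_zero]⟩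
  zero_mem' := ⟨Matrix.isSymm_zero, fun x _ => zero_mulVec x⟩
  smul_mem' := fun c _ hA => ⟨hA.1.smul c, fun x hx => by
    rw [smul_mulVec, hA.2 x hx, smul_zero]⟩

/-- The symmetric matrix `f fᵀ`. -/
def sqMat {K : Type*} [Field K] {n : ℕ} (f : Fin n → K) : Matrix (Fin n) (Fin n) K :=
  vecMulVec f f

/-- The symmetric matrix `f gᵀ + g fᵀ`. -/
def prodMat {K : Type*} [Field K] {n : ℕ} (f g : Fin n → K) : Matrix (Fin n) (Fin n) K :=
  vecMulVec f g + vecMulVec g f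

/-! ### Symmetric matrices: spanning by squares and codimension bounds -/

section SymmetricMatrices

variable {K : Type*} [Field K] {n : ℕ}

lemma sqMat_mulVec (f x : Fin n → K) : sqMat f *ᵥ x = (f ⬝ᵥ x) • f := by
  ext i
  simp [sqMat, vecMulVec_mulVec, mul_comm]

lemma prodMat_mulVec (f g x : Fin n → K) :
    prodMat f g *ᵥ x = (g ⬝ᵥ x) • f + (f ⬝ᵥ x) • g := by
  ext i
  simp [prodMat, add_mulVec, vecMulVec_mulVec, mul_comm]

lemma mem_symMatrices {M : Matrix (Fin n) (Fin n) K} : M ∈ symMatrices K n ↔ M.IsSymm := Iff.rfl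

lemma mulVec_dotProduct_comm {M : Matrix (Fin n) (Fin n) K} (hM : M ∈ symMatrices K n)
    (x y : Fin n → K) : M *ᵥ x ⬝ᵥ y = M *ᵥ y ⬝ᵥ x := by
  rw [dotProduct_comm, dotProduct_mulVec, ← mulVec_transpose, (mem_symMatrices.1 hM).eq]

lemma mem_symVanishingOn {X : Submodule K (Fin n → K)} {M : Matrix (Fin n) (Fin n) K} :
    M ∈ symVanishingOn X ↔ M ∈ symMatrices K n ∧ ∀ x ∈ X, M *ᵥ x = 0 := Iff.rfl

lemma sqMat_mem (f : Fin n → K) : sqMat f ∈ symMatrices K n := by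
  rw [mem_symMatrices, IsSymm, sqMat, transpose_vecMulVec]

lemma prodMat_mem (f g : Fin n → K) : prodMat f g ∈ symMatrices K n := by
  rw [mem_symMatrices, IsSymm, prodMat, transpose_add, transpose_vecMulVec, transpose_vecMulVec,
    add_comm]

lemma symVanishingOn_le (X : Submodule K (Fin n → K)) : symVanishingOn X ≤ symMatrices K n :=
  fun _ hB => hB.1

lemma symVanishingOn_anti {X Y : Submodule K (Fin n → K)} (h : Y ≤ X) :
    symVanishingOn X ≤ symVanishingOn Y :=
  fun _ hB => ⟨hB.1, fun x hx => hB.2 x (h hx)⟩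

lemma prodMat_eq (f g : Fin n → K) :
    prodMat f g = sqMat (f + g) - sqMat f - sqMat g := by
  simp only [prodMat, sqMat, add_vecMulVec, vecMulVec_add]
  abel

/-- The matrices `f fᵀ` span the space of symmetric matrices. -/
lemma symMatrices_le_of_sqMat_mem
    {T : Submodule K (Matrix (Fin n) (Fin n) K)} (h : ∀ f, sqMat f ∈ T) : symMatrices K n ≤ T := by
  intro M hM
  have hp : ∀ f g, prodMat f g ∈ T := fun f g => by
    rw [prodMat_eq]; exact sub_mem (sub_mem (h _) (h _)) (h _)
  let b : Fin n → Fin n → K := fun i => Pi.single i 1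
  have key : ∀ s : Finset (Fin n), ∑ i ∈ s, ∑ j ∈ s, M i j • vecMulVec (b i) (b j) ∈ T := by
    intro s
    induction s using Finset.induction_on with
    | empty => simp
    | insert a s ha ih =>
      have e : ∑ i ∈ insert a s, ∑ j ∈ insert a s, M i j • vecMulVec (b i) (b j) =
          M a a • sqMat (b a) + ∑ j ∈ s, M a j • prodMat (b a) (b j) +
          ∑ i ∈ s, ∑ j ∈ s, M i j • vecMulVec (b i) (b j) := by
        simp only [Finset.sum_insert ha, Finset.sum_add_distrib, prodMat, smul_add, sqMat]
        have : ∑ i ∈ s, M i a • vecMulVec (b i) (b a) =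
          ∑ i ∈ s, M a i • vecMulVec (b i) (b a) :=
          Finset.sum_congr rfl fun i _ => by rw [(mem_symMatrices.1 hM).apply]
        rw [this]
        abel
      rw [e]
      exact add_mem (add_mem (T.smul_mem _ (h _))
        (sum_mem fun j _ => T.smul_mem _ (hp _ _))) ih
  have e : M = ∑ i, ∑ j, M i j • vecMulVec (b i) (b j) := by
    conv_lhs => rw [matrix_eq_sum_single M]
    refine Finset.sum_congr rfl fun i _ => Finset.sum_congr rfl fun j _ => ?_
    rw [← single_eq_single_vecMulVec_single, smul_single, smul_eq_mul, mul_one]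
  rw [e]
  exact key _

lemma exists_dotProduct_eq (φ : (Fin n → K) →ₗ[K] K) : ∃ f : Fin n → K, ∀ x, f ⬝ᵥ x = φ x := by
  refine ⟨fun i => φ (Pi.single i 1), fun x => ?_⟩
  conv_rhs => rw [pi_eq_sum_univ' x, map_sum]
  exact Finset.sum_congr rfl fun i _ => by rw [map_smul, smul_eq_mul, mul_comm]

lemma exists_dotProduct_eq_on (H : Submodule K (Fin n → K)) (φ : H →ₗ[K] K) :
    ∃ f : Fin n → K, ∀ x : H, f ⬝ᵥ (x : Fin n → K) = φ x := by
  obtain ⟨φ', hφ⟩ := φ.exists_extend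
  obtain ⟨f, hf⟩ := exists_dotProduct_eq φ'
  exact ⟨f, fun x => (hf x).trans (LinearMap.congr_fun hφ x)⟩

/-- If `T` contains `f fᵀ` for all `f` that do not vanish on a space of dimension
at least `2`, then it contains all symmetric matrices. -/
lemma exists_sqMat_notMem {T : Submodule K (Matrix (Fin n) (Fin n) K)}
    (hT : ¬ symMatrices K n ≤ T) (H : Submodule K (Fin n → K)) (hH : 2 ≤ Module.finrank K H) :
    ∃ f : Fin n → K, (∃ x ∈ H, f ⬝ᵥ x ≠ 0) ∧ sqMat f ∉ T := by
  by_contra! hcon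
  apply hT
  let b := Module.finBasis K H
  obtain ⟨p, hp⟩ := exists_dotProduct_eq_on H (b.coord ⟨0, by omega⟩)
  obtain ⟨g, hg⟩ := exists_dotProduct_eq_on H (b.coord ⟨1, by omega⟩)
  set i0 : Fin (Module.finrank K H) := ⟨0, by omega⟩
  set i1 : Fin (Module.finrank K H) := ⟨1, by omega⟩
  have h01 : i0 ≠ i1 := by simp [i0, i1]
  have p0 : p ⬝ᵥ b i0 = 1 := by simp [hp]
  have p1 : p ⬝ᵥ b i1 = 0 := by simp [hp, h01.symm]
  have g0 : g ⬝ᵥ b i0 = 0 := by simp [hg, h01]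
  have g1 : g ⬝ᵥ b i1 = 1 := by simp [hg]
  apply symMatrices_le_of_sqMat_mem
  intro f
  by_cases hf : ∃ x ∈ H, f ⬝ᵥ x ≠ 0
  · exact hcon f hf
  push Not at hf
  have f0 := hf _ (b i0).2
  have f1 := hf _ (b i1).2
  -- The quadratic map `sqMat` has vanishing third differences. Every other form in this identity is
  -- nonzero on `H`: on `H` it restricts to `p`, `g` or `p + g`.
  have e : sqMat f = (sqMat (f + p) - sqMat p) + (sqMat (f + g) - sqMat g) -
      (sqMat (f + p + g) - sqMat (p + g)) := by
    simp only [sqMat, add_vecMulVec, vecMulVec_add]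
    abel
  rw [e]
  refine sub_mem (add_mem (sub_mem ?_ ?_) (sub_mem ?_ ?_)) (sub_mem ?_ ?_)
  · exact hcon _ ⟨_, (b i0).2, by simp [f0, p0, add_dotProduct]⟩
  · exact hcon _ ⟨_, (b i0).2, by simp [p0]⟩
  · exact hcon _ ⟨_, (b i1).2, by simp [f1, g1, add_dotProduct]⟩
  · exact hcon _ ⟨_, (b i1).2, by simp [g1]⟩
  · exact hcon _ ⟨_, (b i0).2, by simp [f0, p0, g0, add_dotProduct]⟩
  · exact hcon _ ⟨_, (b i0).2, by simp [p0, g0, add_dotProduct]⟩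

/-- A space of symmetric matrices killed by independent functionals has large codimension. -/
lemma finrank_add_card_le {ι : Type*} [Fintype ι] [DecidableEq ι]
    {R : Submodule K (Matrix (Fin n) (Fin n) K)} (hR : R ≤ symMatrices K n)
    (q : ι → Matrix (Fin n) (Fin n) K →ₗ[K] K) (hq : ∀ i, ∀ B ∈ R, q i B = 0)
    (hs : ∀ i, ∃ B ∈ symMatrices K n, ∀ j, q j B = if j = i then 1 else 0) :
    Module.finrank K R + Fintype.card ι ≤ Module.finrank K (symMatrices K n) := by
  let L : symMatrices K n →ₗ[K] (ι → K) := (LinearMap.pi q).comp (symMatrices K n).subtype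
  have hL : Function.Surjective L := by
    intro t
    choose B hB hBq using hs
    refine ⟨∑ i, t i • ⟨B i, hB i⟩, ?_⟩
    ext j
    simp [L, hBq]
  have h1 := L.finrank_range_add_finrank_ker
  rw [LinearMap.range_eq_top.2 hL, finrank_top, Module.finrank_fintype_fun_eq_card] at h1
  have h2 : Module.finrank K R ≤ Module.finrank K (LinearMap.ker L) := by
    have : R.submoduleOf (symMatrices K n) ≤ LinearMap.ker L := by
      intro B hB
      ext j
      exact hq j _ hB
    calc Module.finrank K R = Module.finrank K (R.submoduleOf (symMatrices K n)) :=
        (Submodule.submoduleOfEquivOfLe hR).finrank_eq.symm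
      _ ≤ _ := Submodule.finrank_mono this
  omega

/-- Linear forms dual to a basis of `P`, vanishing at a vector that is zero or outside `P`. -/
lemma exists_dual_family (P : Submodule K (Fin n → K)) (v : Fin n → K)
    (hv : v ∉ P ∨ v = 0) : ∃ (y f : Fin (Module.finrank K P) → Fin n → K),
    (∀ i, y i ∈ P) ∧ (∀ i j, f i ⬝ᵥ y j = if j = i then 1 else 0) ∧ ∀ i, f i ⬝ᵥ v = 0 := by
  let b := Module.finBasis K P
  have hd : Disjoint P (K ∙ v) := by
    rcases hv with hv | rfl
    · exact Submodule.disjoint_span_singleton.2 fun h => absurd h hv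
    · simp
  obtain ⟨Q, hQv, hQ⟩ := hd.symm.exists_isCompl
  have hQ := hQ.symm
  choose f hf using fun i => exists_dotProduct_eq ((b.coord i).comp (P.projectionOnto Q hQ))
  refine ⟨fun i => b i, f, fun i => (b i).2, fun i j => ?_, fun i => ?_⟩
  · simp [hf, Finsupp.single_apply]
  · have : v ∈ Q := hQv (Submodule.mem_span_singleton_self v)
    simp [hf, (Submodule.projectionOnto_apply_eq_zero_iff hQ).2 this]

/-- The functional `M ↦ (M x) ⬝ᵥ y`. -/
def evalForm (x y : Fin n → K) : Matrix (Fin n) (Fin n) K →ₗ[K] K where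
  toFun M := M *ᵥ x ⬝ᵥ y
  map_add' A B := by rw [add_mulVec, add_dotProduct]
  map_smul' c A := by rw [smul_mulVec, smul_dotProduct, RingHom.id_apply]

lemma evalForm_apply (x y : Fin n → K) (M : Matrix (Fin n) (Fin n) K) :
    evalForm x y M = M *ᵥ x ⬝ᵥ y := rfl

/-- The squares of the forms dual to a basis of `P` are dual to the conditions at that basis,
because these forms can be chosen to vanish at `v`. This is where `v ∉ P ∨ v = 0` is needed. -/
lemma finrank_add_le_of_apply_self_add
    {R : Submodule K (Matrix (Fin n) (Fin n) K)} (hR : R ≤ symMatrices K n)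
    (P : Submodule K (Fin n → K)) (v : Fin n → K)
    (hv : v ∉ P ∨ v = 0) (h : ∀ B ∈ R, ∀ y ∈ P, B *ᵥ y ⬝ᵥ (y + v) = 0) :
    Module.finrank K R + Module.finrank K P ≤ Module.finrank K (symMatrices K n) := by
  obtain ⟨y, f, hy, hf, hfv⟩ := exists_dual_family P v hv
  have := finrank_add_card_le hR (fun i => evalForm (y i) (y i + v))
    (fun i B hB => h B hB _ (hy i))
    (fun i => ⟨sqMat (f i), sqMat_mem _, fun j => by
      rw [evalForm_apply, sqMat_mulVec, smul_dotProduct, dotProduct_add, hfv, hf, add_zero]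
      split_ifs <;> simp⟩)
  simpa using this

lemma exists_dotProduct_eq_one {v : Fin n → K} (hv : v ≠ 0) : ∃ f : Fin n → K, f ⬝ᵥ v = 1 := by
  obtain ⟨i, hi⟩ := Function.ne_iff.1 hv
  exact ⟨Pi.single i (v i)⁻¹, by simpa using inv_mul_cancel₀ hi⟩

lemma finrank_add_le_of_apply
    {R : Submodule K (Matrix (Fin n) (Fin n) K)} (hR : R ≤ symMatrices K n)
    (P : Submodule K (Fin n → K)) (v : Fin n → K)
    (hv : v ≠ 0) (h : ∀ B ∈ R, ∀ y ∈ P, B *ᵥ y ⬝ᵥ v = 0) :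
    Module.finrank K R + Module.finrank K P ≤ Module.finrank K (symMatrices K n) := by
  obtain ⟨y, f, hy, hf, -⟩ := exists_dual_family P 0 (Or.inr rfl)
  obtain ⟨k, hk⟩ := exists_dotProduct_eq_one hv
  have := finrank_add_card_le hR (fun i => evalForm (y i) v)
    (fun i B hB => h B hB _ (hy i))
    -- The multiple of `sqMat k` cancels the unwanted term `(k ⬝ᵥ y) (f i ⬝ᵥ v)`.
    (fun i => ⟨prodMat k (f i) - (f i ⬝ᵥ v) • sqMat k,
      sub_mem (prodMat_mem _ _) (Submodule.smul_mem _ _ (sqMat_mem _)),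
      fun j => by
        rw [map_sub, map_smul, evalForm_apply, evalForm_apply, prodMat_mulVec, sqMat_mulVec]
        simp only [add_dotProduct, smul_dotProduct, hk, hf, smul_eq_mul]
        ring⟩)
  simpa using this

end SymmetricMatrices

/-! ### Root-linear maps and the two-dimensional case -/

section RangeCompatible

variable {K : Type*} [Field K] {n : ℕ}

lemma IsRootLinear.add_self {α : K →+ K} (hα : IsRootLinear K α) (x : K) : α x + α x = 0 := by
  have := hα (-1) x
  simp only [even_two, Even.neg_pow, one_pow, one_smul, neg_smul] at this
  linear_combination this

lemma IsRootLinear.map_sq_mul {α : K →+ K} (hα : IsRootLinear K α) (c x : K) :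
    α (c ^ 2 * x) = c * α x := hα c x

lemma IsRootLinear.sub {α β : K →+ K} (hα : IsRootLinear K α) (hβ : IsRootLinear K β) :
    IsRootLinear K (α - β) := fun c x => by
  rw [AddMonoidHom.sub_apply, AddMonoidHom.sub_apply, hα c x, hβ c x, smul_sub]

/-- The functional equation satisfied by range-compatible maps on `2 × 2` symmetric matrices. -/
lemma exists_rootLinear_of_functional_equation (A G H D : K →+ K)
    (h : ∀ l s t, t * (A (l * s ^ 2) + G (l * (s * t))) = s * (H (l * (s * t)) + D (l * t ^ 2))) :
    ∃ (p q : K) (α : K →+ K), IsRootLinear K α ∧ (∀ x, G x = q * x) ∧ (∀ x, H x = p * x) ∧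
      (∀ x, A x = p * x + α x) ∧ ∀ x, D x = q * x + α x := by
  -- Differencing in `t` avoids any division by 2: `t = 1, 2` give `2G = 2D`, and the second
  -- difference gives `t G(l) + G(lt) = 2D(lt)`. At `l = 1` these combine to linearity of `G`.
  have key : ∀ A G H D : K →+ K,
      (∀ l t, t * (A l + G (l * t)) = H (l * t) + D (l * t ^ 2)) → ∀ x, G x = G 1 * x := by
    intro A G H D e
    have e1 : ∀ l, G l + G l = D l + D l := fun l => by
      have h1 := e l 1
      have h2 := e l (1 + 1)
      have h3 : l * (1 + 1) ^ 2 = l + l + l + l := by ring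
      have h4 : l * (1 + 1) = l + l := by ring
      rw [h3, h4] at h2
      simp only [map_add, mul_one, one_pow, one_mul] at h1 h2
      linear_combination h2 - 2 * h1
    have e2 : ∀ l t, t * G l + G (l * t) = D (l * t) + D (l * t) := fun l t => by
      have h1 := e l 1
      have h2 := e l t
      have h3 := e l (t + 1)
      have h4 : l * (t + 1) ^ 2 = l * t ^ 2 + l * t + l * t + l := by ring
      have h5 : l * (t + 1) = l * t + l := by ring
      rw [h4, h5] at h3
      simp only [map_add, mul_one, one_pow, one_mul] at h1 h2 h3
      linear_combination h3 - h2 - h1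
    intro x
    have h1 := e2 1 x
    have h2 := e1 (1 * x)
    rw [one_mul] at h1 h2
    linear_combination h2 - h1
  have hG := key A G H D fun l t => by simpa using h l 1 t
  have hH := key D H G A fun l t => by
    have := h l t 1
    simp only [mul_one, one_pow, one_mul] at this
    rw [add_comm (D l), ← this, add_comm]
  have hAD : ∀ l, A l - H 1 * l = D l - G 1 * l := fun l => by
    have := h l 1 1
    simp only [mul_one, one_pow, one_mul] at this
    rw [hG l, hH l] at this
    linear_combination this
  refine ⟨H 1, G 1, A - AddMonoidHom.mulLeft (H 1), fun c x => ?_, hG, hH, fun x => by simp,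
    fun x => ?_⟩
  · have := h x 1 c
    simp only [mul_one, one_pow, one_mul] at this
    rw [hG (x * c), hH (x * c)] at this
    have h2 := hAD (x * c ^ 2)
    rw [smul_eq_mul, mul_comm (c ^ 2)]
    simp only [AddMonoidHom.sub_apply, AddMonoidHom.coe_mulLeft, smul_eq_mul]
    linear_combination h2 - this
  · simp only [AddMonoidHom.sub_apply, AddMonoidHom.coe_mulLeft]
    linear_combination -(hAD x)

/-- A range-compatible map on all symmetric matrices, tested on the plane spanned by `a`, `b`. -/
lemma exists_standard_of_pair {a b f g : Fin n → K} (fa : f ⬝ᵥ a = 1) (fb : f ⬝ᵥ b = 0)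
    (ga : g ⬝ᵥ a = 0) (gb : g ⬝ᵥ b = 1) (φ ψ : symMatrices K n →+ K)
    (h : ∀ (B : symMatrices K n) (s t : K), B.1 *ᵥ (s • a + t • b) = 0 → s * φ B + t * ψ B = 0) :
    ∃ (v : Fin n → K) (α : K →+ K), IsRootLinear K α ∧ ∀ B : symMatrices K n,
      φ B = B.1 *ᵥ a ⬝ᵥ v + α (B.1 *ᵥ a ⬝ᵥ a) ∧ ψ B = B.1 *ᵥ b ⬝ᵥ v + α (B.1 *ᵥ b ⬝ᵥ b) := by
  have hφ : ∀ B : symMatrices K n, B.1 *ᵥ a = 0 → φ B = 0 := fun B hB => by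
    simpa using h B 1 0 (by simpa using hB)
  have hψ : ∀ B : symMatrices K n, B.1 *ᵥ b = 0 → ψ B = 0 := fun B hB => by
    simpa using h B 0 1 (by simpa using hB)
  let P : (Fin n → K) → (Fin n → K) → symMatrices K n := fun x y => ⟨prodMat x y, prodMat_mem x y⟩
  let Q : (Fin n → K) → symMatrices K n := fun x => ⟨sqMat x, sqMat_mem x⟩
  have hP : ∀ x y z, (P x y).1 *ᵥ z = (y ⬝ᵥ z) • x + (x ⬝ᵥ z) • y := prodMat_mulVec
  have hQ : ∀ x z, (Q x).1 *ᵥ z = (x ⬝ᵥ z) • x := sqMat_mulVec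
  have hPadd : ∀ x y z, P x (y + z) = P x y + P x z := fun x y z => Subtype.ext <| by
    simp only [P, prodMat, Submodule.coe_add, add_vecMulVec, vecMulVec_add]; abel
  let ℓ : symMatrices K n → K →+ symMatrices K n :=
    fun B => (LinearMap.toSpanSingleton K _ B).toAddMonoidHom
  have hℓ : ∀ B c, ℓ B c = c • B := fun B c => rfl
  obtain ⟨p, q, α, hα, hG, hH, hA, hD⟩ := exists_rootLinear_of_functional_equation
    (φ.comp (ℓ (Q f))) (φ.comp (ℓ (P f g))) (ψ.comp (ℓ (P f g))) (ψ.comp (ℓ (Q g))) (by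
      intro l s t
      simp only [AddMonoidHom.comp_apply, hℓ]
      -- This matrix is `l` times the square of `s f + t g`, so it kills `t a - s b`.
      have h1 := h ((l * s ^ 2) • Q f + (l * (s * t)) • P f g + (l * t ^ 2) • Q g) t (-s) (by
        simp only [Submodule.coe_add, Submodule.coe_smul, add_mulVec, smul_mulVec, hP, hQ,
          dotProduct_add, dotProduct_smul, fa, fb, ga, gb]
        module)
      simp only [map_add] at h1
      rw [hφ ((l * t ^ 2) • Q g) (by simp [smul_mulVec, hQ, ga]),
        hψ ((l * s ^ 2) • Q f) (by simp [smul_mulVec, hQ, fb])] at h1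
      linear_combination h1)
  simp only [AddMonoidHom.comp_apply, hℓ] at hG hH hA hD
  have hmix : ∀ x, x ⬝ᵥ a = 0 → x ⬝ᵥ b = 0 → ∀ s t : K, t * φ (P f (s • x)) = s * ψ (P g (t • x)) := by
    intro x xa xb s t
    have h1 := h (P f (s • x) + P g (t • x)) t (-s) (by
      simp only [Submodule.coe_add, add_mulVec, hP, dotProduct_add, dotProduct_smul,
        smul_dotProduct, fa, fb, ga, gb, xa, xb]
      module)
    rw [map_add, map_add, hφ (P g (t • x)) (by simp [hP, ga, xa]),
      hψ (P f (s • x)) (by simp [hP, fb, xb])] at h1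
    linear_combination h1
  -- Projection onto the vectors orthogonal to `a` and `b`, along `f` and `g`.
  let π : (Fin n → K) → (Fin n → K) := fun x => x - (x ⬝ᵥ a) • f - (x ⬝ᵥ b) • g
  have hπa : ∀ x, π x ⬝ᵥ a = 0 := fun x => by simp [π, sub_dotProduct, fa, ga]
  have hπb : ∀ x, π x ⬝ᵥ b = 0 := fun x => by simp [π, sub_dotProduct, fb, gb]
  have hsw : ∀ x, ψ (P g (π x)) = φ (P f (π x)) := fun x => by
    simpa using (hmix (π x) (hπa x) (hπb x) 1 1).symm
  let κ : (Fin n → K) →ₗ[K] K :=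
    { toFun := fun x => φ (P f (π x))
      map_add' := fun x y => by
        have : π (x + y) = π x + π y := by simp only [π, add_dotProduct]; module
        rw [this, hPadd, map_add]
      map_smul' := fun c x => by
        have : π (c • x) = c • π x := by simp only [π, smul_dotProduct, smul_eq_mul]; module
        rw [this, RingHom.id_apply, smul_eq_mul, ← hsw]
        simpa using hmix (π x) (hπa x) (hπb x) c 1 }
  obtain ⟨w, hw⟩ := exists_dotProduct_eq κ
  have hκ : ∀ x, φ (P f (π x)) = x ⬝ᵥ w := fun x => by rw [dotProduct_comm, hw]; rfl
  refine ⟨p • a + q • b + w, α, hα, fun B => ?_⟩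
  have hc := mulVec_dotProduct_comm B.2 b a
  set u := B.1 *ᵥ a with hu
  set u' := B.1 *ᵥ b with hu'
  -- The subtracted part has the same values at `a` and `b` as `B`, so the remainder is invisible to
  -- `φ` and `ψ`.
  let Z : symMatrices K n := B - ((u ⬝ᵥ a) • Q f + (u ⬝ᵥ b) • P f g + (u' ⬝ᵥ b) • Q g +
    P f (π u) + P g (π u'))
  have hZ : Z.1 *ᵥ a = 0 ∧ Z.1 *ᵥ b = 0 := by
    simp only [Z, Submodule.coe_sub, Submodule.coe_add, Submodule.coe_smul, sub_mulVec, add_mulVec,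
      smul_mulVec, hP, hQ, fa, fb, ga, gb, hπa, hπb, ← hu, ← hu']
    simp only [π, hc]
    constructor <;> module
  have hB : B = (u ⬝ᵥ a) • Q f + (u ⬝ᵥ b) • P f g + (u' ⬝ᵥ b) • Q g +
    P f (π u) + P g (π u') + Z := by simp [Z]
  constructor
  · rw [hB]
    simp only [map_add]
    rw [hφ Z hZ.1, hA, hG, hφ (_ • Q g) (by simp [smul_mulVec, hQ, ga]),
      hφ (P g (π u')) (by simp [hP, ga, hπa]), hκ]
    simp only [dotProduct_add, dotProduct_smul, smul_eq_mul]
    ring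
  · rw [hB]
    simp only [map_add]
    rw [hψ Z hZ.2, hH, hD, hψ (_ • Q f) (by simp [smul_mulVec, hQ, fb]),
      hψ (P f (π u)) (by simp [hP, fb, hπb]), hsw, hκ]
    simp only [dotProduct_add, dotProduct_smul, smul_eq_mul, hc]
    ring

end RangeCompatible

/-! ### Comparing two standard formulas on a common subspace -/

section Gluing

variable {K : Type*} [Field K] {n : ℕ}

/-- The hyperplane orthogonal to `f`. -/
def dotKer (f : Fin n → K) : Submodule K (Fin n → K) where
  carrier := {x | f ⬝ᵥ x = 0}
  add_mem' := fun {x y} (hx : f ⬝ᵥ x = 0) (hy : f ⬝ᵥ y = 0) => by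
    rw [Set.mem_ofPred_eq, dotProduct_add, hx, hy, add_zero]
  zero_mem' := dotProduct_zero f
  smul_mem' := fun c x (hx : f ⬝ᵥ x = 0) => by
    rw [Set.mem_ofPred_eq, dotProduct_smul, hx, smul_zero]

lemma mem_dotKer {f x : Fin n → K} : x ∈ dotKer f ↔ f ⬝ᵥ x = 0 := Iff.rfl

lemma finrank_inf_dotKer {X : Submodule K (Fin n → K)} {f x : Fin n → K} (hx : x ∈ X)
    (hfx : f ⬝ᵥ x ≠ 0) : Module.finrank K ↥(X ⊓ dotKer f) + 1 = Module.finrank K X := by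
  let L : X →ₗ[K] K :=
    { toFun := fun y => f ⬝ᵥ (y : Fin n → K)
      map_add' := fun y z => by simp [dotProduct_add]
      map_smul' := fun c y => by simp [dotProduct_smul] }
  have hL : Function.Surjective L := fun c => ⟨(c / (f ⬝ᵥ x)) • ⟨x, hx⟩, by
    simpa [L, dotProduct_smul] using div_mul_cancel₀ c hfx⟩
  have h1 := L.finrank_range_add_finrank_ker
  rw [LinearMap.range_eq_top.2 hL, finrank_top, Module.finrank_self] at h1
  have h2 : (LinearMap.ker L).map X.subtype = X ⊓ dotKer f := by
    ext y
    simp [L, mem_dotKer, and_comm]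
  rw [← h2, Submodule.finrank_map_subtype_eq X (LinearMap.ker L)]
  omega

/-- The symmetric matrices `M` such that `(M y) ⬝ᵥ (c y + v) = 0` for all `y ∈ Y`. -/
def symIsotropicOn (Y : Submodule K (Fin n → K)) (c : K) (v : Fin n → K) :
    Submodule K (Matrix (Fin n) (Fin n) K) :=
  symMatrices K n ⊓ ⨅ y ∈ Y, LinearMap.ker (evalForm y (c • y + v))

lemma mem_symIsotropicOn {Y : Submodule K (Fin n → K)} {c : K} {v : Fin n → K}
    {M : Matrix (Fin n) (Fin n) K} : M ∈ symIsotropicOn Y c v ↔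
      M ∈ symMatrices K n ∧ ∀ y ∈ Y, M *ᵥ y ⬝ᵥ (c • y + v) = 0 := by
  simp only [symIsotropicOn, Submodule.mem_inf, Submodule.mem_iInf, LinearMap.mem_ker,
    evalForm_apply]

variable {T : Submodule K (Matrix (Fin n) (Fin n) K)} {Y : Submodule K (Fin n → K)}
  {f₁ f₂ v : Fin n → K}

/-- The dimensions force `T` to equal the whole isotropic space. That space contains `f₁ f₁ᵀ`, since
`f₁` vanishes on `Y`, and it is proper since `Y ≠ 0`; both options in `hg` are excluded. -/
lemma false_of_finrank_symIsotropicOn (hT : T ≤ symMatrices K n)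
    (hdim : Module.finrank K (symMatrices K n) ≤ Module.finrank K T + Module.finrank K Y)
    (hY : 0 < Module.finrank K Y) (hf : ∀ y ∈ Y, f₁ ⬝ᵥ y = 0)
    (hg : T = symMatrices K n ∨ sqMat f₁ ∉ T) (c : K)
    (hTA : ∀ B ∈ T, ∀ y ∈ Y, B *ᵥ y ⬝ᵥ (c • y + v) = 0)
    (hA : Module.finrank K (symIsotropicOn Y c v) + Module.finrank K Y ≤
      Module.finrank K (symMatrices K n)) : False := by
  have hle : T ≤ symIsotropicOn Y c v := fun B hB => mem_symIsotropicOn.2 ⟨hT hB, hTA B hB⟩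
  have heq : T = symIsotropicOn Y c v := Submodule.eq_of_le_of_finrank_le hle (by omega)
  rcases hg with rfl | hg
  · have := Submodule.finrank_mono hle
    omega
  · apply hg
    rw [heq, mem_symIsotropicOn]
    exact ⟨sqMat_mem _, fun y hy => by simp [sqMat_mulVec, hf y hy]⟩

lemma false_of_apply_eq_zero (hT : T ≤ symMatrices K n)
    (hdim : Module.finrank K (symMatrices K n) ≤ Module.finrank K T + Module.finrank K Y)
    (hY : 0 < Module.finrank K Y) (hf : ∀ y ∈ Y, f₁ ⬝ᵥ y = 0)
    (hg : T = symMatrices K n ∨ sqMat f₁ ∉ T) (hv : v ≠ 0)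
    (hTA : ∀ B ∈ T, ∀ y ∈ Y, B *ᵥ y ⬝ᵥ v = 0) : False := by
  refine false_of_finrank_symIsotropicOn hT hdim hY hf hg 0 (v := v) (by simpa using hTA) ?_
  refine finrank_add_le_of_apply inf_le_left Y v hv fun B hB y hy => ?_
  simpa using (mem_symIsotropicOn.1 hB).2 y hy

lemma false_of_apply_self_add_eq_zero (hT : T ≤ symMatrices K n)
    (hdim : Module.finrank K (symMatrices K n) ≤ Module.finrank K T + Module.finrank K Y)
    (hY : 0 < Module.finrank K Y) (hf : ∀ y ∈ Y, f₁ ⬝ᵥ y = 0)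
    (hg : T = symMatrices K n ∨ sqMat f₁ ∉ T) (hv : v ∉ Y ∨ v = 0)
    (hTA : ∀ B ∈ T, ∀ y ∈ Y, B *ᵥ y ⬝ᵥ (y + v) = 0) : False := by
  refine false_of_finrank_symIsotropicOn hT hdim hY hf hg 1 (v := v) (by simpa using hTA) ?_
  refine finrank_add_le_of_apply_self_add inf_le_left Y v hv fun B hB y hy => ?_
  simpa using (mem_symIsotropicOn.1 hB).2 y hy

/-- A standard map that vanishes on a large space is zero, unless the field has two elements. -/
lemma standard_eq_zero_or (hT : T ≤ symMatrices K n)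
    (hdim : Module.finrank K (symMatrices K n) ≤ Module.finrank K T + Module.finrank K Y)
    (hY : 0 < Module.finrank K Y) (hf : ∀ y ∈ Y, f₁ ⬝ᵥ y = 0)
    (hg : T = symMatrices K n ∨ sqMat f₁ ∉ T) {α : K →+ K} (hα : IsRootLinear K α)
    (h : ∀ B ∈ T, ∀ y ∈ Y, B *ᵥ y ⬝ᵥ v + α (B *ᵥ y ⬝ᵥ y) = 0) :
    (v = 0 ∧ α = 0) ∨ ((∀ c : K, c = 0 ∨ c = 1) ∧ (∀ x, α x = x) ∧ v ∈ Y ∧ v ≠ 0) := by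
  by_cases hα0 : α = 0
  · by_cases hv : v = 0
    · exact Or.inl ⟨hv, hα0⟩
    · exact (false_of_apply_eq_zero hT hdim hY hf hg hv
        fun B hB y hy => by simpa [hα0] using h B hB y hy).elim
  obtain ⟨x₀, hx₀⟩ : ∃ x, α x ≠ 0 := by
    by_contra! hcon
    exact hα0 (AddMonoidHom.ext hcon)
  by_cases hK : ∀ c : K, c = 0 ∨ c = 1
  · have hid : ∀ x, α x = x := by
      have h1 : α 1 = 1 := by
        rcases hK x₀ with rfl | rfl
        · simp at hx₀
        · exact (hK _).resolve_left hx₀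
      intro x
      rcases hK x with rfl | rfl
      · simp
      · exact h1
    by_cases hv : v ∉ Y ∨ v = 0
    · refine (false_of_apply_self_add_eq_zero hT hdim hY hf hg hv fun B hB y hy => ?_).elim
      have := h B hB y hy
      rw [hid] at this
      rw [dotProduct_add, add_comm, this]
    · push Not at hv
      exact Or.inr ⟨hK, hid, hv⟩
  · exfalso
    push Not at hK
    -- Scaling `B` by `c ^ 2` multiplies the linear term by `c ^ 2` but the root-linear term only by
    -- `c`, so for `c ≠ 0, 1` the two terms vanish separately.
    obtain ⟨c, hc0, hc1⟩ := hK
    have hz : ∀ B ∈ T, ∀ y ∈ Y, α (B *ᵥ y ⬝ᵥ y) = 0 := fun B hB y hy => by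
      have h1 := h B hB y hy
      have h2 := h (c ^ 2 • B) (T.smul_mem _ hB) y hy
      simp only [smul_mulVec, smul_dotProduct, smul_eq_mul, hα.map_sq_mul] at h2
      have h3 : (c * (1 - c)) * α (B *ᵥ y ⬝ᵥ y) = 0 := by linear_combination h2 - c ^ 2 * h1
      exact (mul_eq_zero.1 h3).resolve_left (mul_ne_zero hc0 (sub_ne_zero.2 hc1.symm))
    have hz' : ∀ B ∈ T, ∀ y ∈ Y, B *ᵥ y ⬝ᵥ y = 0 := fun B hB y hy => by
      by_contra hne
      have := hz ((x₀ / (B *ᵥ y ⬝ᵥ y)) • B) (T.smul_mem _ hB) y hy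
      rw [smul_mulVec, smul_dotProduct, smul_eq_mul, div_mul_cancel₀ _ hne] at this
      exact hx₀ this
    by_cases hv : v = 0
    · exact false_of_apply_self_add_eq_zero hT hdim hY hf hg (v := 0) (Or.inr rfl)
        fun B hB y hy => by simpa using hz' B hB y hy
    · refine false_of_apply_eq_zero hT hdim hY hf hg hv fun B hB y hy => ?_
      simpa [hz B hB y hy] using h B hB y hy

/-- The exceptional configuration over the field with two elements does not occur. -/
lemma false_of_exceptional (hK : ∀ c : K, c = 0 ∨ c = 1) (hT : T ≤ symMatrices K n)
    (hdim : Module.finrank K (symMatrices K n) ≤ Module.finrank K T + Module.finrank K Y)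
    (hf₁ : ∀ y ∈ Y, f₁ ⬝ᵥ y = 0) (hf₂ : ∀ y ∈ Y, f₂ ⬝ᵥ y = 0) {e e' : Fin n → K}
    (h1e : f₁ ⬝ᵥ e = 1) (h2e : f₂ ⬝ᵥ e = 0) (h1e' : f₁ ⬝ᵥ e' = 0) (h2e' : f₂ ⬝ᵥ e' = 1)
    (hg : T = symMatrices K n ∨ (sqMat f₁ ∉ T ∧ sqMat f₂ ∉ T)) (hvY : v ∈ Y) (hv : v ≠ 0)
    (h : ∀ B ∈ T, ∀ y ∈ Y, B *ᵥ y ⬝ᵥ (y + v) = 0)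
    (hker : ∀ B ∈ T, ∀ z ∈ Y, B *ᵥ (e + e' + z) = 0 → B *ᵥ e ⬝ᵥ (e + v) = 0) : False := by
  have h2 : (1 + 1 : K) = 0 := by
    rcases hK (-1) with h | h
    · simp at h
    · nth_rewrite 1 [← h]; ring
  have h1v := hf₁ v hvY
  have h2v := hf₂ v hvY
  have hB₀ : sqMat (f₁ + f₂) ∉ T := fun hB => by
    have := hker _ hB 0 Y.zero_mem (by
      simp [sqMat_mulVec, dotProduct_add, add_dotProduct, h1e, h2e, h1e', h2e', h2])
    simp [sqMat_mulVec, dotProduct_add, add_dotProduct, h1e, h2e, h1v, h2v] at this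
  rcases hg with rfl | ⟨hg₁, hg₂⟩
  · exact hB₀ (sqMat_mem _)
  obtain ⟨f₀, hf₀⟩ := exists_dotProduct_eq_one hv
  have hle : T ≤ symIsotropicOn Y 1 v := fun B hB =>
    mem_symIsotropicOn.2 ⟨hT hB, by simpa using h B hB⟩
  -- The condition at `y = v` is void because `2 = 0`. Restricting to a hyperplane of `Y` that
  -- misses `v` loses one dimension, so `T` has codimension at most 1 in the isotropic space.
  have hA := finrank_add_le_of_apply_self_add (R := symIsotropicOn Y 1 v) inf_le_left
    (Y ⊓ dotKer f₀) v (Or.inl fun hmem => by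
      have := mem_dotKer.1 hmem.2
      simp [hf₀] at this)
    (fun B hB y hy => by simpa using (mem_symIsotropicOn.1 hB).2 y hy.1)
  have hY := finrank_inf_dotKer (f := f₀) hvY (by simp [hf₀])
  -- Over two elements, a subspace of codimension at most 1 has at most one nontrivial coset.
  have hadd : ∀ B ∈ symIsotropicOn Y 1 v, ∀ C ∈ symIsotropicOn Y 1 v, B ∉ T → C ∉ T →
      B + C ∈ T := by
    intro B hB C hC hBT hCT
    have hlt : T < T ⊔ K ∙ B := by
      refine lt_of_le_of_ne le_sup_left fun heq => hBT ?_
      rw [heq]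
      exact Submodule.mem_sup_right (Submodule.mem_span_singleton_self B)
    have hle' : T ⊔ K ∙ B ≤ symIsotropicOn Y 1 v :=
      sup_le hle ((Submodule.span_singleton_le_iff_mem _ _).2 hB)
    have heq := Submodule.eq_of_le_of_finrank_le hle' (by
      have := Submodule.finrank_lt_finrank_of_lt hlt
      omega)
    rw [← heq] at hC
    obtain ⟨t, ht, s, hs, rfl⟩ := Submodule.mem_sup.1 hC
    obtain ⟨c, rfl⟩ := Submodule.mem_span_singleton.1 hs
    rcases hK c with rfl | rfl
    · simp [ht] at hCT
    · have : B + (t + (1 : K) • B) = t + (1 + 1 : K) • B := by module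
      rw [this, h2, zero_smul, add_zero]
      exact ht
  obtain ⟨f, hfv, hfe⟩ : ∃ f : Fin n → K, f ⬝ᵥ v = 1 ∧ f ⬝ᵥ e + f ⬝ᵥ e' = 1 := by
    refine ⟨f₀ + (1 - f₀ ⬝ᵥ e - f₀ ⬝ᵥ e') • f₁, ?_, ?_⟩
    · simp [add_dotProduct, smul_dotProduct, hf₀, h1v]
    · simp only [add_dotProduct, smul_dotProduct, h1e, h1e', smul_eq_mul]
      ring
  have hsqA : ∀ g : Fin n → K, (∀ y ∈ Y, g ⬝ᵥ y = 0) → sqMat g ∈ symIsotropicOn Y 1 v :=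
    fun g hg => mem_symIsotropicOn.2 ⟨sqMat_mem _, fun y hy => by simp [sqMat_mulVec, hg y hy]⟩
  have hfA : prodMat f (f₁ + f₂) ∈ symIsotropicOn Y 1 v :=
    mem_symIsotropicOn.2 ⟨prodMat_mem _ _, fun y hy => by
      simp [prodMat_mulVec, dotProduct_add, add_dotProduct, hf₁ y hy, hf₂ y hy, h1v, h2v]⟩
  have hfT : prodMat f (f₁ + f₂) ∉ T := fun hB => by
    have := hker _ hB v hvY (by
      rw [prodMat_mulVec]
      simp only [dotProduct_add, add_dotProduct, h1e, h2e, h1e', h2e', h1v, h2v, hfv, hfe, h2,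
        add_zero, zero_add, zero_smul])
    simp only [prodMat_mulVec, dotProduct_add, add_dotProduct, smul_dotProduct,
      h1e, h2e, h1v, h2v, hfv, smul_eq_mul] at this
    exact one_ne_zero (α := K) (by linear_combination this - f ⬝ᵥ e * h2)
  -- Four isotropic matrices outside `T` add up to an element of `T`. The sum kills `e + e'`, yet
  -- pairs `e` with `e + v` to `1`, against `hker`.
  have hC := add_mem (hadd _ (hsqA f₁ hf₁) _ (hsqA f₂ hf₂) hg₁ hg₂)
    (hadd _ (hsqA (f₁ + f₂) fun y hy => by simp [add_dotProduct, hf₁ y hy, hf₂ y hy]) _ hfA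
      hB₀ hfT)
  have := hker _ hC 0 Y.zero_mem (by
    simp only [add_mulVec, sqMat_mulVec, prodMat_mulVec, add_zero, dotProduct_add, add_dotProduct,
      h1e, h2e, h1e', h2e', hfe, zero_add, h2, zero_smul, one_smul]
    have : f₁ + f₂ + (f₁ + f₂) = (1 + 1 : K) • (f₁ + f₂) := by module
    rw [this, h2, zero_smul])
  simp only [add_mulVec, sqMat_mulVec, prodMat_mulVec, dotProduct_add, add_dotProduct,
    smul_dotProduct, h1e, h2e, h1v, h2v, hfv, smul_eq_mul] at this
  exact one_ne_zero (α := K) (by linear_combination this - (1 + f ⬝ᵥ e) * h2)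

end Gluing

/-! ### Induction on the test subspace -/

section Main

variable {K : Type*} [Field K] {n : ℕ}

/-- The vectors on which a given linear form agrees with the standard one attached to `v`, `α`. -/
def standardLocus (M : symMatrices K n) (v z : Fin n → K) {α : K →+ K} (hα : IsRootLinear K α) :
    Submodule K (Fin n → K) where
  carrier := {x | z ⬝ᵥ x = M.1 *ᵥ x ⬝ᵥ v + α (M.1 *ᵥ x ⬝ᵥ x)}
  -- The cross term of the quadratic form is doubled, and `α` kills doubles.
  add_mem' := fun {x y} hx hy => by
    simp only [Set.mem_ofPred_eq, dotProduct_add, mulVec_add, add_dotProduct, map_add] at hx hy ⊢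
    rw [mulVec_dotProduct_comm M.2 y x]
    linear_combination hx + hy - hα.add_self (M.1 *ᵥ x ⬝ᵥ y)
  zero_mem' := by simp
  smul_mem' := fun c x hx => by
    simp only [Set.mem_ofPred_eq, dotProduct_smul, mulVec_smul, smul_dotProduct] at hx ⊢
    rw [smul_smul, ← pow_two, hα, hx, smul_add]

lemma mem_standardLocus {M : symMatrices K n} {v z x : Fin n → K} {α : K →+ K}
    {hα : IsRootLinear K α} : x ∈ standardLocus M v z hα ↔
      z ⬝ᵥ x = M.1 *ᵥ x ⬝ᵥ v + α (M.1 *ᵥ x ⬝ᵥ x) := Iff.rfl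

variable {S : Submodule K (Matrix (Fin n) (Fin n) K)} {F : S →+ (Fin n → K)}

lemma exists_standard_on_of_finrank_eq_two (hS : S ≤ symMatrices K n)
    (hF : ∀ (B : S) (x : Fin n → K), B.1 *ᵥ x = 0 → F B ⬝ᵥ x = 0) {X : Submodule K (Fin n → K)}
    (hX : Module.finrank K X = 2) (hSX : symMatrices K n ≤ S ⊔ symVanishingOn X) :
    ∃ (v : Fin n → K) (α : K →+ K), IsRootLinear K α ∧
      ∀ B : S, ∀ x ∈ X, F B ⬝ᵥ x = B.1 *ᵥ x ⬝ᵥ v + α (B.1 *ᵥ x ⬝ᵥ x) := by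
  let b := Module.finBasisOfFinrankEq K X hX
  obtain ⟨f, hf⟩ := exists_dotProduct_eq_on X (b.coord 0)
  obtain ⟨g, hg⟩ := exists_dotProduct_eq_on X (b.coord 1)
  have hlift : ∀ B : symMatrices K n, ∃ s : S, ∀ x ∈ X, s.1 *ᵥ x = B.1 *ᵥ x := fun B => by
    obtain ⟨s, hs, z, hz, hsz⟩ := Submodule.mem_sup.1 (hSX B.2)
    exact ⟨⟨s, hs⟩, fun x hx => by rw [← hsz, add_mulVec, hz.2 x hx, add_zero]⟩
  -- The lift need not be additive: `F (σ B) ⬝ᵥ x` depends only on `B x` for `x ∈ X`, so it is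
  -- additive in `B`.
  choose σ hσ using hlift
  have hwd : ∀ s t : S, ∀ x ∈ X, s.1 *ᵥ x = t.1 *ᵥ x → F s ⬝ᵥ x = F t ⬝ᵥ x := by
    intro s t x _ hst
    have := hF (s - t) x (by rw [Submodule.coe_sub, sub_mulVec, hst, sub_self])
    rwa [map_sub, sub_dotProduct, sub_eq_zero] at this
  let Φ : X → (symMatrices K n →+ K) := fun x => AddMonoidHom.mk' (fun B => F (σ B) ⬝ᵥ x.1)
    fun B C => by
      rw [← add_dotProduct, ← map_add]
      exact hwd _ _ x x.2 (by
        rw [hσ _ x x.2, Submodule.coe_add, Submodule.coe_add, add_mulVec, add_mulVec, hσ _ x x.2,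
          hσ _ x x.2])
  obtain ⟨v, α, hα, h⟩ := exists_standard_of_pair (a := (b 0 : Fin n → K)) (b := b 1) (f := f)
    (g := g) (by simp [hf]) (by simp [hf]) (by simp [hg]) (by simp [hg]) (Φ (b 0)) (Φ (b 1)) (by
      intro B s t h0
      have := hF (σ B) (s • (b 0 : Fin n → K) + t • (b 1 : Fin n → K)) (by
        rw [hσ B _ (add_mem (X.smul_mem s (b 0).2) (X.smul_mem t (b 1).2)), h0])
      rwa [dotProduct_add, dotProduct_smul, dotProduct_smul] at this)
  refine ⟨v, α, hα, fun B x hx => ?_⟩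
  let B' : symMatrices K n := ⟨B.1, hS B.2⟩
  have hB := h B'
  have hΦ : ∀ y : X, Φ y B' = F B ⬝ᵥ y.1 := fun y => hwd _ _ y y.2 (hσ B' y y.2)
  rw [hΦ, hΦ] at hB
  have h0 : (b 0 : Fin n → K) ∈ standardLocus B' v (F B) hα := hB.1
  have h1 : (b 1 : Fin n → K) ∈ standardLocus B' v (F B) hα := hB.2
  have hx' := congrArg Subtype.val (b.sum_repr ⟨x, hx⟩)
  rw [Fin.sum_univ_two] at hx'
  have : x ∈ standardLocus B' v (F B) hα := by
    rw [show x = _ from hx'.symm]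
    exact add_mem (Submodule.smul_mem _ _ h0) (Submodule.smul_mem _ _ h1)
  exact this

/-- A range-compatible map is standard when tested on `X`, provided that the restriction of `S`
to `X` has codimension at most `dim X - 2`. -/
lemma exists_standard_on (hS : S ≤ symMatrices K n)
    (hF : ∀ (B : S) (x : Fin n → K), B.1 *ᵥ x = 0 → F B ⬝ᵥ x = 0) (m : ℕ) :
    ∀ X : Submodule K (Fin n → K), Module.finrank K X = m →
      Module.finrank K (symMatrices K n) + 2 ≤ Module.finrank K ↥(S ⊔ symVanishingOn X) + m →
      ∃ (v : Fin n → K) (α : K →+ K), IsRootLinear K α ∧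
        ∀ B : S, ∀ x ∈ X, F B ⬝ᵥ x = B.1 *ᵥ x ⬝ᵥ v + α (B.1 *ᵥ x ⬝ᵥ x) := by
  have hle : ∀ X, S ⊔ symVanishingOn X ≤ symMatrices K n := fun X =>
    sup_le hS (symVanishingOn_le X)
  induction m with
  | zero =>
    intro X _ hdim
    have := Submodule.finrank_mono (hle X)
    omega
  | succ k ih =>
    intro X hX hdim
    have hmono := Submodule.finrank_mono (hle X)
    -- Dimension 1 contradicts `hdim`, so past this case `dim X ≥ 3`.
    by_cases hk : k = 1
    · subst hk
      refine exists_standard_on_of_finrank_eq_two hS hF hX ?_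
      exact (Submodule.eq_of_le_of_finrank_le (hle X) (by omega)).ge
    set T := S ⊔ symVanishingOn X with hTdef
    have hchoice : ∀ H : Submodule K (Fin n → K), 2 ≤ Module.finrank K H →
        ∃ f : Fin n → K, (∃ x ∈ H, f ⬝ᵥ x ≠ 0) ∧ (T = symMatrices K n ∨ sqMat f ∉ T) := by
      intro H hH
      by_cases hT : symMatrices K n ≤ T
      · have hne : H ≠ ⊥ := by
          rintro rfl
          simp at hH
        obtain ⟨x, hx, hx0⟩ := Submodule.exists_mem_ne_zero_of_ne_bot hne
        obtain ⟨f, hf⟩ := exists_dotProduct_eq_one hx0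
        exact ⟨f, ⟨x, hx, by simp [hf]⟩, Or.inl (le_antisymm (hle X) hT)⟩
      · obtain ⟨f, hf, hfT⟩ := exists_sqMat_notMem hT H hH
        exact ⟨f, hf, Or.inr hfT⟩
    obtain ⟨f₁, ⟨x₁, hx₁, hfx₁⟩, hg₁⟩ := hchoice X (by omega)
    have hX₁ := finrank_inf_dotKer hx₁ hfx₁
    -- Choosing `f₂` nonzero on `X ⊓ dotKer f₁` makes `f₁`, `f₂` independent on `X`.
    obtain ⟨f₂, ⟨x₂, hx₂, hfx₂⟩, hg₂⟩ := hchoice (X ⊓ dotKer f₁) (by omega)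
    have hY := finrank_inf_dotKer hx₂ hfx₂
    have hX₂ := finrank_inf_dotKer (Submodule.mem_inf.1 hx₂).1 hfx₂
    set Y := X ⊓ dotKer f₁ ⊓ dotKer f₂ with hYdef
    obtain ⟨e', he'X, h1e', h2e'⟩ : ∃ e' ∈ X, f₁ ⬝ᵥ e' = 0 ∧ f₂ ⬝ᵥ e' = 1 :=
      ⟨(f₂ ⬝ᵥ x₂)⁻¹ • x₂, X.smul_mem _ hx₂.1,
        by rw [dotProduct_smul, mem_dotKer.1 hx₂.2, smul_zero],
        by rw [dotProduct_smul, smul_eq_mul, inv_mul_cancel₀ hfx₂]⟩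
    obtain ⟨e, heX, h1e, h2e⟩ : ∃ e ∈ X, f₁ ⬝ᵥ e = 1 ∧ f₂ ⬝ᵥ e = 0 := by
      refine ⟨(f₁ ⬝ᵥ x₁)⁻¹ • x₁ - ((f₁ ⬝ᵥ x₁)⁻¹ * (f₂ ⬝ᵥ x₁)) • e',
        sub_mem (X.smul_mem _ hx₁) (X.smul_mem _ he'X), ?_, ?_⟩
      · rw [dotProduct_sub, dotProduct_smul, dotProduct_smul, h1e', smul_eq_mul,
          inv_mul_cancel₀ hfx₁, smul_zero, sub_zero]
      · rw [dotProduct_sub, dotProduct_smul, dotProduct_smul, h2e', smul_eq_mul, smul_eq_mul,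
          mul_one, sub_self]
    have hstep : ∀ f : Fin n → K, Module.finrank K ↥(X ⊓ dotKer f) + 1 = Module.finrank K X →
        (T = symMatrices K n ∨ sqMat f ∉ T) → ∃ (v : Fin n → K) (α : K →+ K), IsRootLinear K α ∧
          ∀ B : S, ∀ x ∈ X ⊓ dotKer f, F B ⬝ᵥ x = B.1 *ᵥ x ⬝ᵥ v + α (B.1 *ᵥ x ⬝ᵥ x) := by
      intro f hf hg
      refine ih (X ⊓ dotKer f) (by omega) ?_
      have hTT : T ≤ S ⊔ symVanishingOn (X ⊓ dotKer f) :=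
        sup_le_sup_left (symVanishingOn_anti inf_le_left) S
      rcases hg with hg | hg
      · have h1 := Submodule.finrank_mono hTT
        rw [hg] at h1
        omega
      · have hlt : T < S ⊔ symVanishingOn (X ⊓ dotKer f) := by
          refine lt_of_le_of_ne hTT fun heq => hg ?_
          rw [heq]
          refine Submodule.mem_sup_right (mem_symVanishingOn.2 ⟨sqMat_mem f, fun x hx => ?_⟩)
          rw [sqMat_mulVec, mem_dotKer.1 hx.2, zero_smul]
        have := Submodule.finrank_lt_finrank_of_lt hlt
        omega
    obtain ⟨v₁, α₁, hα₁, H₁⟩ := hstep f₁ hX₁ hg₁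
    obtain ⟨v₂, α₂, hα₂, H₂⟩ := hstep f₂ hX₂ hg₂
    have hYX₁ : ∀ y ∈ Y, y ∈ X ⊓ dotKer f₁ := fun y hy => hy.1
    have hYX₂ : ∀ y ∈ Y, y ∈ X ⊓ dotKer f₂ := fun y hy => ⟨hy.1.1, hy.2⟩
    have hYf₁ : ∀ y ∈ Y, f₁ ⬝ᵥ y = 0 := fun y hy => mem_dotKer.1 hy.1.2
    have hYf₂ : ∀ y ∈ Y, f₂ ⬝ᵥ y = 0 := fun y hy => mem_dotKer.1 hy.2
    have hrep : ∀ B ∈ T, ∃ s : S, ∀ x ∈ X, B *ᵥ x = s.1 *ᵥ x := fun B hB => by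
      obtain ⟨s, hs, z, hz, rfl⟩ := Submodule.mem_sup.1 hB
      exact ⟨⟨s, hs⟩, fun x hx => by rw [add_mulVec, hz.2 x hx, add_zero]⟩
    have hdiff : ∀ B ∈ T, ∀ y ∈ Y,
        B *ᵥ y ⬝ᵥ (v₂ - v₁) + (α₂ - α₁) (B *ᵥ y ⬝ᵥ y) = 0 := fun B hB y hy => by
      obtain ⟨s, hs⟩ := hrep B hB
      rw [hs y hy.1.1, dotProduct_sub, AddMonoidHom.sub_apply]
      linear_combination H₁ s y (hYX₁ y hy) - H₂ s y (hYX₂ y hy)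
    rcases standard_eq_zero_or (T := T) (hle X) (by omega) (by omega) hYf₁ hg₁ (hα₂.sub hα₁) hdiff with
      ⟨hv, hα⟩ | ⟨hK, hid, hvY, hv⟩
    · obtain rfl := sub_eq_zero.1 hv
      obtain rfl := sub_eq_zero.1 hα
      refine ⟨v₂, α₂, hα₂, fun B x hx => ?_⟩
      have m₁ : (f₂ ⬝ᵥ x) • e' ∈ standardLocus ⟨B.1, hS B.2⟩ v₂ (F B) hα₂ :=
        Submodule.smul_mem _ _ (H₁ B e' ⟨he'X, h1e'⟩)
      have m₂ : x - (f₂ ⬝ᵥ x) • e' ∈ standardLocus ⟨B.1, hS B.2⟩ v₂ (F B) hα₂ :=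
        H₂ B _ ⟨sub_mem hx (X.smul_mem _ he'X), mem_dotKer.2 (by
          rw [dotProduct_sub, dotProduct_smul, h2e', smul_eq_mul, mul_one, sub_self])⟩
      have := add_mem m₂ m₁
      rwa [sub_add_cancel] at this
    · exfalso
      refine false_of_exceptional (T := T) hK (hle X) (Y := Y) (by omega) hYf₁ hYf₂ h1e h2e h1e' h2e'
        (by tauto) hvY hv (fun B hB y hy => ?_) (fun B hB z hz h0 => ?_)
      · have := hdiff B hB y hy
        rw [hid] at this
        rw [dotProduct_add, add_comm, this]
      · have hzX := hz.1.1
        obtain ⟨s, hs⟩ := hrep B hB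
        rw [hs _ (add_mem (add_mem heX he'X) hzX)] at h0
        rw [hs e heX]
        -- The sum `e + e' + z` lies in neither hyperplane, but splits as `e` plus `e' + z`, one in
        -- each. Range-compatibility there is information that the agreement on `Y` does not
        -- contain.
        have hw := H₁ s (e' + z) (add_mem ⟨he'X, h1e'⟩ (hYX₁ z hz))
        have he := H₂ s e ⟨heX, h2e⟩
        have h3 := hF s _ h0
        rw [add_assoc, dotProduct_add, hw, he] at h3
        rw [add_assoc, mulVec_add] at h0
        have h4 : s.1 *ᵥ (e' + z) = -(s.1 *ᵥ e) := (neg_eq_of_add_eq_zero_right h0).symm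
        have h5 : s.1 *ᵥ (e' + z) ⬝ᵥ (e' + z) = s.1 *ᵥ e ⬝ᵥ e := by
          rw [h4, neg_dotProduct, mulVec_dotProduct_comm (hS s.2), h4, neg_dotProduct, neg_neg]
        rw [h5, h4, neg_dotProduct] at h3
        have h6 := hid (s.1 *ᵥ e ⬝ᵥ e)
        rw [AddMonoidHom.sub_apply] at h6
        rw [dotProduct_add, dotProduct_sub]
        linear_combination h3 - h6 - hα₁.add_self (s.1 *ᵥ e ⬝ᵥ e)

end Main

/-! ### From test vectors back to matrices and diagonals -/

section Standard

variable {K : Type*} [Field K] {n : ℕ}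

lemma mem_range_mulVecLin_iff {M : Matrix (Fin n) (Fin n) K} (hM : M ∈ symMatrices K n)
    (y : Fin n → K) :
    y ∈ LinearMap.range M.mulVecLin ↔ ∀ x, M *ᵥ x = 0 → y ⬝ᵥ x = 0 := by
  constructor
  · rintro ⟨z, rfl⟩ x hx
    rw [mulVecLin_apply, mulVec_dotProduct_comm hM, hx, zero_dotProduct]
  · intro h
    by_contra hy
    obtain ⟨φ, hφy, hφ⟩ := Submodule.exists_dual_map_eq_bot_of_notMem hy inferInstance
    obtain ⟨f, hf⟩ := exists_dotProduct_eq φ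
    apply hφy
    rw [← hf, dotProduct_comm]
    refine h f (dotProduct_eq_zero _ fun w => ?_)
    rw [mulVec_dotProduct_comm hM, dotProduct_comm, hf]
    have : φ (M *ᵥ w) ∈ (LinearMap.range M.mulVecLin).map φ := ⟨_, ⟨w, rfl⟩, rfl⟩
    rwa [hφ, Submodule.mem_bot] at this

/-- Off-diagonal terms of the quadratic form occur twice and are killed by `α`. Here this is
packaged in `standardLocus` being a subspace, so a check on basis vectors suffices. -/
lemma IsRootLinear.sum_diag {α : K →+ K} (hα : IsRootLinear K α) {M : Matrix (Fin n) (Fin n) K}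
    (hM : M ∈ symMatrices K n) (x : Fin n → K) :
    (fun i => α (M.diag i)) ⬝ᵥ x = α (M *ᵥ x ⬝ᵥ x) := by
  have h : (⊤ : Submodule K (Fin n → K)) ≤
      standardLocus ⟨M, hM⟩ 0 (fun i => α (M.diag i)) hα := by
    rw [← (Pi.basisFun K (Fin n)).span_eq, Submodule.span_le]
    rintro _ ⟨i, rfl⟩
    simp [SetLike.mem_coe, mem_standardLocus]
  simpa using mem_standardLocus.1 (h (Submodule.mem_top : x ∈ ⊤))

variable {S : Submodule K (Matrix (Fin n) (Fin n) K)}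

lemma isRangeCompatible_iff (hS : S ≤ symMatrices K n) (F : S → (Fin n → K)) :
    IsRangeCompatible F ↔ ∀ (B : S) (x : Fin n → K), B.1 *ᵥ x = 0 → F B ⬝ᵥ x = 0 :=
  forall_congr' fun B => mem_range_mulVecLin_iff (hS B.2) (F B)

lemma isRangeCompatible_of_standard (hS : S ≤ symMatrices K n) {F : S → (Fin n → K)}
    {v : Fin n → K} {α : K →+ K} (hα : IsRootLinear K α)
    (h : ∀ M : S, F M = M.1 *ᵥ v + fun i => α (M.1.diag i)) : IsRangeCompatible F := by
  rw [isRangeCompatible_iff hS]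
  intro B x hx
  rw [h B, add_dotProduct, hα.sum_diag (hS B.2), mulVec_dotProduct_comm (hS B.2), hx]
  simp

lemma exists_standard (hS : S ≤ symMatrices K n) (hcodim : (symCodim S : ℤ) ≤ (n : ℤ) - 2)
    (F : S →+ (Fin n → K)) (hF : IsRangeCompatible (F : S → (Fin n → K))) :
    ∃ (v : Fin n → K) (α : K →+ K), IsRootLinear K α ∧
      ∀ M : S, F M = M.1 *ᵥ v + fun i => α (M.1.diag i) := by
  have hdim : Module.finrank K (symMatrices K n) + 2 ≤
      Module.finrank K ↥(S ⊔ symVanishingOn (⊤ : Submodule K (Fin n → K))) + n := by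
    have h1 := (S.submoduleOf (symMatrices K n)).finrank_quotient_add_finrank
    rw [(Submodule.submoduleOfEquivOfLe hS).finrank_eq] at h1
    have h2 := Submodule.finrank_mono
      (le_sup_left : S ≤ S ⊔ symVanishingOn (⊤ : Submodule K (Fin n → K)))
    unfold symCodim at hcodim
    omega
  obtain ⟨v, α, hα, h⟩ := exists_standard_on hS ((isRangeCompatible_iff hS F).1 hF) n ⊤
    (by simp) hdim
  refine ⟨v, α, hα, fun M => dotProduct_eq _ _ fun x => ?_⟩
  rw [h M x Submodule.mem_top, add_dotProduct, hα.sum_diag (hS M.2),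
    mulVec_dotProduct_comm (hS M.2)]

/-- The standard additive map `M ↦ M v + α (diag M)`. -/
def standardHom (S : Submodule K (Matrix (Fin n) (Fin n) K)) (v : Fin n → K) (α : K →+ K) :
    S →+ (Fin n → K) :=
  AddMonoidHom.mk' (fun M => M.1 *ᵥ v + fun i => α (M.1.diag i)) fun A B => by
    ext i
    simp only [Submodule.coe_add, add_mulVec, diag_apply, Matrix.add_apply, map_add, Pi.add_apply]
    abel

end Standard

theorem mainTheorem1 {K : Type*} [Field K] {n : ℕ}
    (S : Submodule K (Matrix (Fin n) (Fin n) K)) (hS : S ≤ symMatrices K n)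
    (hcodim : (symCodim S : ℤ) ≤ (n : ℤ) - 2) :
    (∀ F : S →+ (Fin n → K), IsRangeCompatible (F : S → (Fin n → K)) → IsStandard hS F) ∧
    (ringChar K ≠ 2 → ∀ F : S →+ (Fin n → K),
      IsRangeCompatible (F : S → (Fin n → K)) ↔ IsLocalMap (F : S → (Fin n → K))) ∧
    (ringChar K = 2 → ∀ F : S →+ (Fin n → K),
      IsRangeCompatible (F : S → (Fin n → K)) ↔
        ∃ (L : S →+ (Fin n → K)) (α : K →+ K),
          IsLocalMap (L : S → (Fin n → K)) ∧ IsRootLinear K α ∧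
          ∀ M : S, F M = L M + fun i => α ((M : Matrix (Fin n) (Fin n) K).diag i)) := by
  refine ⟨fun F hF => ?_, fun hchar F => ⟨fun hF => ?_, ?_⟩, fun _ F => ⟨fun hF => ?_, ?_⟩⟩
  · obtain ⟨v, α, hα, h⟩ := exists_standard hS hcodim F hF
    exact ⟨hF, standardHom _ v α, isRangeCompatible_of_standard le_rfl hα fun _ => rfl,
      fun M => (h M).symm⟩
  · obtain ⟨v, α, hα, h⟩ := exists_standard hS hcodim F hF
    have hα0 : ∀ x, α x = 0 := fun x => by
      have := hα.add_self x
      rw [← two_mul] at this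
      exact (mul_eq_zero.1 this).resolve_left (Ring.two_ne_zero hchar)
    refine ⟨v, fun M => ?_⟩
    rw [h M]
    simp only [hα0]
    exact add_zero _
  · rintro ⟨v, h⟩ M
    exact ⟨v, (h M).symm⟩
  · obtain ⟨v, α, hα, h⟩ := exists_standard hS hcodim F hF
    exact ⟨standardHom S v 0, α, ⟨v, fun M => add_zero _⟩, hα, fun M => by
      rw [h M, show standardHom S v 0 M = M.1 *ᵥ v from add_zero _]⟩
  · rintro ⟨L, α, ⟨v, hv⟩, hα, h⟩
    exact isRangeCompatible_of_standard hS hα fun M => by rw [h M, hv M]
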